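/- **Theorem 3.2.** Let $n\ge 1$, let $\mathcal E$ be a complex Hilbert space, let $\mathcal E_n=H^2_{\mathcal E}(\mathbb D^n)$ be the $\mathcal E$-valued Hardy space over the polydisc (the reproducing kernel Hilbert space with kernel $\prod_{i=1}^n(1-z_i\bar w_i)^{-1}I_{\mathcal E}$), and let $H^2_{\mathcal E_n}(\mathbb D)$ be the $\mathcal E_n$-valued Hardy space over the disc $\mathbb D$. Let $M_z$ be multiplication by the coordinate on $H^2_{\mathcal E_n}(\mathbb D)$. For $i=1,\dots,n$ let $\kappa_i(w)=M_{z_i}\in\mathcal B(\mathcal E_n)$ $(w\in\mathbb D)$ be the constant function whose value is multiplication by $z_i$ on $\mathcal E_n$, and let $(M_{\kappa_i}f)(w)=\kappa_i(w)f(w)$. Let $\mathcal S\subseteq H^2_{\mathcal E_n}(\mathbb D)$ be a closed subspace, let $\mathcal W=\mathcal S\ominus z\mathcal S=\mathcal S\cap(z\mathcal S)^\perp$, and for $w\in\mathbb D$ and $i=1,\dots,n$ let $$\Phi_i(w)=P_{\mathcal W}\,\bigl(I_{\mathcal S}-wP_{\mathcal S}M_z^*|_{\mathcal S}\bigr)^{-1}P_{\mathcal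 S}M_{\kappa_i}|_{\mathcal W}\in\mathcal B(\mathcal W),$$ where the inverse is taken in $\mathcal B(\mathcal S)$ (the projection $P_{\mathcal S}$ in front of $M_{\kappa_i}$ may be omitted if $M_{\kappa_i}\mathcal S\subseteq\mathcal S$). Then $\mathcal S$ is invariant for $(M_z,M_{\kappa_1},\dots,M_{\kappa_n})$ if and only if 1. $(M_{\Phi_1},\dots,M_{\Phi_n})$ is an $n$-tuple of commuting shifts on $H^2_{\mathcal W}(\mathbb D)$, that is, each $(M_{\Phi_i}f)(w)=\Phi_i(w)f(w)$ defines a bounded operator on $H^2_{\mathcal W}(\mathbb D)$, these operators commute, and each of them is an isometry with no nonzero closed reducing subspace on which it is unitary; and 2. there is an inner function $\Theta\in H^\infty_{\mathcal B(\mathcal W,\mathcal E_n)}(\mathbb D)$, that is, a bounded analytic function $\Theta:\mathbb D\to\mathcal B(\mathcal W,\mathcal E_n)$ for which $M_\Theta:H^2_{\mathcal W}(\mathbb D)\to H^2_{\mathcal E_n}(\mathbb D)$, $(M_\Theta g)(w)=\Theta(w)g(w)$, is an isometry, such that $$\mathcal S=\Theta H^2_{\mathcal W}(\mathbb D)\qquad\text{and}\qquad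 \kappa_i\Theta=\Theta\Phi_i\quad(i=1,\dots,n).$$ -/

import Mathlib

open scoped Complex.UnitDisc ENNReal ComplexConjugate

noncomputable section

/-! ### Monomials on the polydisc -/

/-- The monomial `z ^ k = z₁ ^ k₁ ⋯ zₙ ^ kₙ` at a point `z` of the polydisc `𝔻ⁿ`. -/
def polyMono {n : ℕ} (z : Fin n → 𝔻) (k : Fin n → ℕ) : ℂ := ∏ i, (z i : ℂ) ^ k i

theorem summable_hasSum_mul {ι κ : Type*} {f : ι → ℂ} {g : κ → ℂ} {s t : ℂ}
    (hf : Summable fun i => ‖f i‖) (hg : Summable fun j => ‖g j‖) (hs : HasSum f s)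
    (ht : HasSum g t) : Summable (fun p : ι × κ => ‖f p.1 * g p.2‖) ∧
      HasSum (fun p : ι × κ => f p.1 * g p.2) (s * t) :=
  ⟨hf.mul_norm hg, hs.mul ht (summable_mul_of_summable_norm hf hg)⟩

/-- The geometric series in `n` variables. -/
theorem hasSum_prod_pow (n : ℕ) : ∀ (a : Fin n → ℂ), (∀ i, ‖a i‖ < 1) →
    Summable (fun k : Fin n → ℕ => ‖∏ i, a i ^ k i‖) ∧
      HasSum (fun k : Fin n → ℕ => ∏ i, a i ^ k i) (∏ i, (1 - a i)⁻¹) := by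
  induction n with
  | zero =>
    intro a _
    refine ⟨Summable.of_finite, ?_⟩
    simp only [Finset.univ_eq_empty, Finset.prod_empty]
    exact hasSum_unique (fun _ : Fin 0 → ℕ => (1 : ℂ))
  | succ n ih =>
    intro a ha
    obtain ⟨hs, hsum⟩ := ih (fun i => a i.succ) (fun i => ha i.succ)
    have g1 : Summable (fun m : ℕ => ‖a 0 ^ m‖) := by
      simpa using summable_geometric_of_lt_one (norm_nonneg _) (ha 0)
    have g2 : HasSum (fun m : ℕ => a 0 ^ m) (1 - a 0)⁻¹ := hasSum_geometric_of_norm_lt_one (ha 0)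
    obtain ⟨h1, h2⟩ := summable_hasSum_mul g1 hs g2 hsum
    have e : ∀ p : ℕ × (Fin n → ℕ), ∏ i, a i ^ (Fin.consEquiv (fun _ => ℕ) p : Fin (n + 1) → ℕ) i =
        a 0 ^ p.1 * ∏ i, a i.succ ^ p.2 i := by
      intro p
      simp [Fin.prod_univ_succ, Fin.consEquiv]
    rw [Fin.prod_univ_succ]
    constructor
    · refine (Equiv.summable_iff (Fin.consEquiv fun _ => ℕ)).mp (h1.congr fun p => ?_)
      exact congrArg norm (e p).symm
    · refine (Equiv.hasSum_iff (Fin.consEquiv fun _ => ℕ)).mp ?_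
      rw [← funext e] at h2
      exact h2

theorem summable_norm_polyMono {n : ℕ} (z : Fin n → 𝔻) :
    Summable (fun k : Fin n → ℕ => ‖polyMono z k‖) :=
  (hasSum_prod_pow n (fun i => (z i : ℂ)) fun i => (z i).norm_lt_one).1

theorem summable_polyMono_smul {n : ℕ} {E : Type*} [NormedAddCommGroup E] [NormedSpace ℂ E]
    [CompleteSpace E] (z : Fin n → 𝔻) {a : (Fin n → ℕ) → E} {C : ℝ} (ha : ∀ k, ‖a k‖ ≤ C) :
    Summable fun k => polyMono z k • a k := by
  refine Summable.of_norm_bounded ((summable_norm_polyMono z).mul_right C) fun k => ?_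
  rw [norm_smul]
  exact mul_le_mul_of_nonneg_left (ha k) (norm_nonneg _)

/-- A power series in one variable which vanishes on the disc has zero coefficients. -/
theorem coeff_eq_zero_one {E : Type*} [NormedAddCommGroup E] [NormedSpace ℂ E]
    [CompleteSpace E] {c : ℕ → E} {C : ℝ} (hc : ∀ m, ‖c m‖ ≤ C)
    (h : ∀ w : 𝔻, ∑' m, (w : ℂ) ^ m • c m = 0) (m : ℕ) : c m = 0 := by
  let p : FormalMultilinearSeries ℂ ℂ E := fun m => ContinuousMultilinearMap.mkPiRing ℂ (Fin m) (c m)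
  have hr : (1 : ℝ≥0∞) ≤ p.radius := by
    have := p.le_radius_of_bound C (r := 1) fun m => by simpa [p] using hc m
    simpa using this
  have hp : HasFPowerSeriesAt p.sum p 0 :=
    (p.hasFPowerSeriesOnBall (lt_of_lt_of_le one_pos hr)).hasFPowerSeriesAt
  have h0 : HasFPowerSeriesAt (0 : ℂ → E) p 0 := by
    refine hp.congr ?_
    filter_upwards [Metric.ball_mem_nhds (0 : ℂ) one_pos] with w hw
    have := h (Complex.UnitDisc.mk w (by simpa using hw))
    simpa [FormalMultilinearSeries.sum, p] using this
  simpa [p] using h0.apply_eq_zero m 1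

/-- A power series which vanishes on the polydisc has zero coefficients. -/
theorem coeff_eq_zero {E : Type*} [NormedAddCommGroup E] [NormedSpace ℂ E]
    [CompleteSpace E] : ∀ (n : ℕ) (a : (Fin n → ℕ) → E) (C : ℝ), (∀ k, ‖a k‖ ≤ C) →
    (∀ z : Fin n → 𝔻, ∑' k, polyMono z k • a k = 0) → ∀ k, a k = 0
  | 0, a, C, _, h, k => by
    have := h Fin.elim0
    rw [tsum_eq_single k (fun b hb => absurd (Subsingleton.elim b k) hb)] at this
    simpa [polyMono] using this
  | n + 1, a, C, ha, h, k => by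
    have key : ∀ (z : Fin n → 𝔻) (m : ℕ),
        ∑' k : Fin n → ℕ, polyMono z k • a (Fin.cons m k) = 0 := by
      intro z
      have hb : ∀ m, ‖∑' k : Fin n → ℕ, polyMono z k • a (Fin.cons m k)‖ ≤
          ∑' k : Fin n → ℕ, ‖polyMono z k‖ * C := fun m =>
        tsum_of_norm_bounded ((summable_norm_polyMono z).mul_right C).hasSum fun k => by
          rw [norm_smul]
          exact mul_le_mul_of_nonneg_left (ha _) (norm_nonneg _)
      refine coeff_eq_zero_one hb fun w => ?_
      have e : (fun k : Fin (n + 1) → ℕ => polyMono (Fin.cons w z) k • a k) ∘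
          (Fin.consEquiv fun _ => ℕ) =
          fun p : ℕ × (Fin n → ℕ) => (w : ℂ) ^ p.1 • polyMono z p.2 • a (Fin.cons p.1 p.2) := by
        funext p
        simp [polyMono, Fin.prod_univ_succ, Fin.consEquiv, mul_smul]
      have hs := summable_polyMono_smul (Fin.cons w z : Fin (n + 1) → 𝔻) ha
      rw [← (Fin.consEquiv fun _ => ℕ).summable_iff, e] at hs
      have h1 := h (Fin.cons w z)
      rw [← (Fin.consEquiv fun _ => ℕ).tsum_eq] at h1
      have h2 : ∑' p : ℕ × (Fin n → ℕ),
          (w : ℂ) ^ p.1 • polyMono z p.2 • a (Fin.cons p.1 p.2) = 0 := by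
        rw [← h1]
        exact tsum_congr fun p => (congrFun e p).symm
      rw [hs.tsum_prod] at h2
      rw [← h2]
      exact tsum_congr fun m =>
        ((summable_polyMono_smul z (a := fun k => a (Fin.cons m k)) fun k => ha _).tsum_const_smul
          ((w : ℂ) ^ m)).symm
    have := coeff_eq_zero n (fun k' => a (Fin.cons (k 0) k')) C (fun _ => ha _)
      (fun z => key z (k 0)) (Fin.tail k)
    simpa using this

/-! ### Vector-valued Hardy spaces over the polydisc -/

/-- The Hardy space `H²_E(𝔻ⁿ)`: the Hilbert space of the functions
`f(z) = ∑ₖ z ^ k • aₖ` on `𝔻ⁿ` with `∑ₖ ‖aₖ‖² < ∞` and `‖f‖² = ∑ₖ ‖aₖ‖²`. An element is stored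
through its Taylor coefficients; it is coerced to a function on `𝔻ⁿ` by the `RKHS` instance below,
and `HardySpace.kernel_eq` shows that the reproducing kernel is the Szegő kernel times `I_E`. -/
def HardySpace (n : ℕ) (E : Type*) [NormedAddCommGroup E] : Type _ :=
  lp (fun _ : Fin n → ℕ => E) 2

namespace HardySpace

section Basic

variable {n : ℕ} {E : Type*} [NormedAddCommGroup E]

instance : NormedAddCommGroup (HardySpace n E) :=
  inferInstanceAs (NormedAddCommGroup (lp (fun _ : Fin n → ℕ => E) 2))

instance [InnerProductSpace ℂ E] : InnerProductSpace ℂ (HardySpace n E) :=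
  inferInstanceAs (InnerProductSpace ℂ (lp (fun _ : Fin n → ℕ => E) 2))

instance [CompleteSpace E] : CompleteSpace (HardySpace n E) :=
  inferInstanceAs (CompleteSpace (lp (fun _ : Fin n → ℕ => E) 2))

/-- The linear isometry from the Hardy space onto the space of square summable coefficients. -/
def toLp [InnerProductSpace ℂ E] : HardySpace n E ≃ₗᵢ[ℂ] lp (fun _ : Fin n → ℕ => E) 2 :=
  LinearIsometryEquiv.refl ℂ (lp (fun _ : Fin n → ℕ => E) 2)

/-- The `k`-th Taylor coefficient. -/
def coeff [InnerProductSpace ℂ E] (f : HardySpace n E) (k : Fin n → ℕ) : E := toLp f k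

/-- The element of the Hardy space with given square summable Taylor coefficients. -/
def ofCoeff (a : (Fin n → ℕ) → E) (ha : Memℓp a 2) : HardySpace n E :=
  (⟨a, ha⟩ : lp (fun _ : Fin n → ℕ => E) 2)

@[simp] theorem coeff_ofCoeff [InnerProductSpace ℂ E] (a : (Fin n → ℕ) → E) (ha : Memℓp a 2) :
    (ofCoeff a ha).coeff = a := rfl

@[simp] theorem coeff_add [InnerProductSpace ℂ E] (f g : HardySpace n E) :
    (f + g).coeff = f.coeff + g.coeff := rfl

@[simp] theorem coeff_smul [InnerProductSpace ℂ E] (c : ℂ) (f : HardySpace n E) :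
    (c • f).coeff = c • f.coeff := rfl

theorem coeff_ext [InnerProductSpace ℂ E] {f g : HardySpace n E}
    (h : ∀ k, f.coeff k = g.coeff k) : f = g :=
  toLp.injective (lp.ext (funext h))

theorem inner_eq_tsum [InnerProductSpace ℂ E] (f g : HardySpace n E) :
    inner ℂ f g = ∑' k, inner ℂ (f.coeff k) (g.coeff k) :=
  lp.inner_eq_tsum (toLp f) (toLp g)

theorem summable_sq [InnerProductSpace ℂ E] (f : HardySpace n E) :
    Summable fun k => ‖f.coeff k‖ ^ (2 : ℝ≥0∞).toReal :=
  (lp.memℓp (toLp f)).summable (by simp)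

theorem norm_eq [InnerProductSpace ℂ E] (f : HardySpace n E) :
    ‖f‖ = (∑' k, ‖f.coeff k‖ ^ (2 : ℝ≥0∞).toReal) ^ (1 / (2 : ℝ≥0∞).toReal) :=
  lp.norm_eq_tsum_rpow (by simp) (toLp f)

theorem norm_coeff_le [InnerProductSpace ℂ E] (f : HardySpace n E) (k : Fin n → ℕ) :
    ‖f.coeff k‖ ≤ ‖f‖ := by
  rw [← (toLp (n := n) (E := E)).norm_map f]
  exact lp.norm_apply_le_norm (by simp) (toLp f) k

variable [InnerProductSpace ℂ E] [CompleteSpace E]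

/-- Point evaluation `f ↦ f(z) = ∑ₖ z ^ k • aₖ`. -/
def evalCLM (z : Fin n → 𝔻) : HardySpace n E →L[ℂ] E :=
  LinearMap.mkContinuous
    { toFun := fun f => ∑' k, polyMono z k • f.coeff k
      map_add' := fun f g => by
        rw [← (summable_polyMono_smul z f.norm_coeff_le).tsum_add
          (summable_polyMono_smul z g.norm_coeff_le)]
        exact tsum_congr fun k => by rw [coeff_add, Pi.add_apply, smul_add]
      map_smul' := fun c f => by
        rw [RingHom.id_apply, ← (summable_polyMono_smul z f.norm_coeff_le).tsum_const_smul c]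
        exact tsum_congr fun k => by rw [coeff_smul, Pi.smul_apply, smul_comm] }
    (∑' k, ‖polyMono z k‖) fun f => by
      rw [← tsum_mul_right]
      refine tsum_of_norm_bounded ((summable_norm_polyMono z).mul_right ‖f‖).hasSum fun k => ?_
      rw [norm_smul]
      exact mul_le_mul_of_nonneg_left (f.norm_coeff_le k) (norm_nonneg _)

/-- The Hardy space is a reproducing kernel Hilbert space of `E`-valued functions on `𝔻ⁿ`. -/
instance : RKHS ℂ (HardySpace n E) (Fin n → 𝔻) E where
  coeCLM := ContinuousLinearMap.pi evalCLM
  coeCLM_injective := by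
    refine (injective_iff_map_eq_zero _).mpr fun f hf => ?_
    refine (toLp (n := n) (E := E)).map_eq_zero_iff.mp (lp.ext (funext fun k => ?_))
    exact coeff_eq_zero n f.coeff ‖f‖ f.norm_coeff_le (fun z => congrFun hf z) k

theorem apply_eq (f : HardySpace n E) (z : Fin n → 𝔻) :
    f z = ∑' k, polyMono z k • f.coeff k := rfl

/-- The reproducing kernel of the Hardy space is `(z, w) ↦ ∏ᵢ (1 - zᵢ w̄ᵢ)⁻¹ I_E`. -/
theorem kernel_eq (z w : Fin n → 𝔻) :
    RKHS.kernel (HardySpace n E) z w =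
      (∏ i, (1 - (z i : ℂ) * conj (w i : ℂ))⁻¹) • ContinuousLinearMap.id ℂ E := by
  ext v
  have hle : ∀ k, ‖polyMono w k‖ ≤ 1 := fun k => by
    rw [polyMono, norm_prod]
    refine Finset.prod_le_one (fun _ _ => norm_nonneg _) fun i _ => ?_
    rw [norm_pow]
    exact pow_le_one₀ (norm_nonneg _) (w i).norm_lt_one.le
  let g : HardySpace n E := ofCoeff (fun k => conj (polyMono w k) • v) (by
    refine memℓp_gen (((summable_norm_polyMono w).mul_right (‖v‖ ^ 2)).of_nonneg_of_le
      (fun k => by positivity) fun k => ?_)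
    simp only [norm_smul, RCLike.norm_conj, ENNReal.toReal_ofNat, Real.rpow_ofNat, mul_pow]
    refine mul_le_mul_of_nonneg_right ?_ (by positivity)
    rw [sq]
    exact mul_le_of_le_one_left (norm_nonneg _) (hle k))
  have hg : RKHS.kerFun (HardySpace n E) w v = g := by
    refine ext_inner_right ℂ fun f => ?_
    rw [RKHS.kerFun_inner, inner_eq_tsum, apply_eq,
      ← innerSL_apply_apply ℂ, (innerSL ℂ v).map_tsum (summable_polyMono_smul w f.norm_coeff_le)]
    refine tsum_congr fun k => ?_
    rw [innerSL_apply_apply, inner_smul_right]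
    rw [coeff_ofCoeff, inner_smul_left, RCLike.conj_conj]
  rw [← RKHS.kerFun_apply, hg, apply_eq]
  have hlt : ∀ i, ‖(z i : ℂ) * conj (w i : ℂ)‖ < 1 := fun i => by
    rw [norm_mul, RCLike.norm_conj]
    exact mul_lt_one_of_nonneg_of_lt_one_left (norm_nonneg _) (z i).norm_lt_one
      (w i).norm_lt_one.le
  have hsum := (hasSum_prod_pow n _ hlt).2.smul_const v
  rw [_root_.smul_apply, ContinuousLinearMap.id_apply, ← hsum.tsum_eq]
  refine tsum_congr fun k => ?_
  rw [coeff_ofCoeff, smul_smul]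
  simp [polyMono, mul_pow, Finset.prod_mul_distrib]

end Basic

/-! ### Multiplication operators -/

section Index

variable {n : ℕ} {E : Type*} [NormedAddCommGroup E]

/-- Translation of the exponents by the `i`-th unit vector. -/
def shiftIdx (i : Fin n) (k : Fin n → ℕ) : Fin n → ℕ := k + Pi.single i 1

theorem shiftIdx_injective (i : Fin n) : Function.Injective (shiftIdx i) :=
  fun _ _ h => add_right_cancel h

theorem norm_extend_sq (i : Fin n) (a : (Fin n → ℕ) → E) :
    (fun k => ‖Function.extend (shiftIdx i) a 0 k‖ ^ (2 : ℝ≥0∞).toReal) =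
      Function.extend (shiftIdx i) (fun k => ‖a k‖ ^ (2 : ℝ≥0∞).toReal) 0 := by
  funext k
  by_cases hk : ∃ j, shiftIdx i j = k
  · obtain ⟨j, rfl⟩ := hk
    simp [(shiftIdx_injective i).extend_apply]
  · simp [Function.extend_apply' _ _ _ hk]

theorem extend_shiftIdx (i : Fin n) (a : (Fin n → ℕ) → E) (j : Fin n → ℕ) :
    Function.extend (shiftIdx i) a 0 (shiftIdx i j) = a j :=
  (shiftIdx_injective i).extend_apply _ _ _

end Index

section Operators

variable {n : ℕ} {E F : Type*} [NormedAddCommGroup E] [InnerProductSpace ℂ E]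
  [NormedAddCommGroup F] [InnerProductSpace ℂ F]

/-- The operator `M_{z_i}` of multiplication by the `i`-th coordinate, `(M_{z_i} f)(z) = z_i f(z)`
(see `mulCoord_apply`); it moves the coefficient at `k` to `k + eᵢ`. -/
def mulCoord (i : Fin n) : HardySpace n E →L[ℂ] HardySpace n E :=
  LinearMap.mkContinuous
    { toFun := fun f => ofCoeff (Function.extend (shiftIdx i) f.coeff 0) (by
        refine memℓp_gen ?_
        rw [norm_extend_sq]
        exact (summable_extend_zero (shiftIdx_injective i)).mpr f.summable_sq)
      map_add' := fun f g => coeff_ext fun k => by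
        simp only [coeff_add, Pi.add_apply, coeff_ofCoeff]
        by_cases hk : ∃ j, shiftIdx i j = k
        · obtain ⟨j, rfl⟩ := hk
          rw [extend_shiftIdx, extend_shiftIdx, extend_shiftIdx, Pi.add_apply]
        · simp [Function.extend_apply' _ _ _ hk]
      map_smul' := fun c f => coeff_ext fun k => by
        simp only [RingHom.id_apply, coeff_smul, Pi.smul_apply, coeff_ofCoeff]
        by_cases hk : ∃ j, shiftIdx i j = k
        · obtain ⟨j, rfl⟩ := hk
          rw [extend_shiftIdx, extend_shiftIdx, Pi.smul_apply]
        · simp [Function.extend_apply' _ _ _ hk] }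
    1 fun f => by
      rw [one_mul, norm_eq, norm_eq]
      refine le_of_eq (congrArg (· ^ _) ?_)
      simp only [LinearMap.coe_mk, AddHom.coe_mk, coeff_ofCoeff]
      rw [norm_extend_sq, tsum_extend_zero (shiftIdx_injective i)]

theorem coeff_mulCoord (i : Fin n) (f : HardySpace n E) :
    (mulCoord i f).coeff = Function.extend (shiftIdx i) f.coeff 0 := rfl

theorem mulCoord_apply [CompleteSpace E] (i : Fin n) (f : HardySpace n E) (z : Fin n → 𝔻) :
    mulCoord i f z = (z i : ℂ) • f z := by
  rw [apply_eq, apply_eq, coeff_mulCoord,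
    ← (summable_polyMono_smul z f.norm_coeff_le).tsum_const_smul,
    ← tsum_extend_zero (shiftIdx_injective i) fun k => (z i : ℂ) • polyMono z k • f.coeff k]
  refine tsum_congr fun k => ?_
  by_cases hk : ∃ j, shiftIdx i j = k
  · obtain ⟨j, rfl⟩ := hk
    rw [extend_shiftIdx, extend_shiftIdx, smul_smul]
    congr 1
    simp only [polyMono, shiftIdx, Pi.add_apply, pow_add, Finset.prod_mul_distrib,
      Pi.single_apply, pow_ite, pow_one, pow_zero, Finset.prod_ite_eq', Finset.mem_univ, if_true]
    ring
  · simp [Function.extend_apply' _ _ _ hk]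

/-- The operator `M_K` of multiplication by a constant operator-valued function `z ↦ K`,
`(M_K f)(z) = K (f z)` (see `mulConst_apply`). -/
def mulConst (K : E →L[ℂ] F) : HardySpace n E →L[ℂ] HardySpace n F :=
  (toLp (n := n) (E := F)).symm.toContinuousLinearEquiv.toContinuousLinearMap ∘L
    lp.mapCLM 2 (fun _ => K) (norm_nonneg K) (fun _ => le_rfl) ∘L
    (toLp (n := n) (E := E)).toContinuousLinearEquiv.toContinuousLinearMap

theorem mulConst_apply [CompleteSpace E] [CompleteSpace F] (K : E →L[ℂ] F) (f : HardySpace n E)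
    (z : Fin n → 𝔻) : mulConst K f z = K (f z) := by
  rw [apply_eq, apply_eq, K.map_tsum (summable_polyMono_smul z f.norm_coeff_le)]
  refine tsum_congr fun k => ?_
  rw [map_smul]
  rfl

end Operators

end HardySpace

/-! ### Operator-valued functions on the disc, shifts, wandering subspaces -/

section Disc

variable {E F : Type*} [NormedAddCommGroup E] [InnerProductSpace ℂ E] [CompleteSpace E]
  [NormedAddCommGroup F] [InnerProductSpace ℂ F] [CompleteSpace F]

/-- The value at `w ∈ 𝔻` of a function `f ∈ H²_E(𝔻)`. -/
abbrev HardySpace.evalAt (f : HardySpace 1 E) (w : 𝔻) : E := f fun _ => w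

/-- The bounded operator `T : H²_E(𝔻) → H²_F(𝔻)` is the multiplication operator `M_Φ`,
`(M_Φ f)(w) = Φ(w) f(w)`, of the operator-valued function `Φ` on `𝔻`. -/
def IsMulOp (Φ : ℂ → E →L[ℂ] F) (T : HardySpace 1 E →L[ℂ] HardySpace 1 F) : Prop :=
  ∀ (f : HardySpace 1 E) (w : 𝔻), (T f).evalAt w = Φ w (f.evalAt w)

/-- `Θ ∈ H^∞_{B(E,F)}(𝔻)`: a bounded analytic operator-valued function on the disc. -/
def IsBoundedAnalytic (Θ : ℂ → E →L[ℂ] F) : Prop :=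
  DifferentiableOn ℂ Θ (Metric.ball 0 1) ∧ ∃ C : ℝ, ∀ w ∈ Metric.ball (0 : ℂ) 1, ‖Θ w‖ ≤ C

/-- `Θ` is an inner function (isometric multiplier): it lies in `H^∞_{B(E,F)}(𝔻)` and
`M_Θ : H²_E(𝔻) → H²_F(𝔻)` is an isometry. -/
def IsInner (Θ : ℂ → E →L[ℂ] F) : Prop :=
  IsBoundedAnalytic Θ ∧
    ∃ T : HardySpace 1 E →L[ℂ] HardySpace 1 F, IsMulOp Θ T ∧ ∀ f, ‖T f‖ = ‖f‖

/-- A bounded operator `V` is a shift: it is an isometry, and there is no nontrivial closed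
subspace which reduces `V` and on which `V` is unitary. -/
def IsShift (V : E →L[ℂ] E) : Prop :=
  (∀ x, ‖V x‖ = ‖x‖) ∧
    ∀ M : Submodule ℂ E, IsClosed (M : Set E) →
      (∀ x ∈ M, V x ∈ M) → (∀ x ∈ M, ContinuousLinearMap.adjoint V x ∈ M) →
      (∀ y ∈ M, ∃ x ∈ M, V x = y) → M = ⊥

/-- The operator `M_z` on `H²_E(𝔻)`. -/
abbrev shiftZ : HardySpace 1 E →L[ℂ] HardySpace 1 E := HardySpace.mulCoord 0

/-- `W = S ⊖ zS`, the orthogonal complement of `zS` in `S`. -/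
def wandering (S : ClosedSubmodule ℂ (HardySpace 1 E)) : Submodule ℂ (HardySpace 1 E) :=
  S.toSubmodule ⊓ (S.toSubmodule.map (shiftZ (E := E)).toLinearMap)ᗮ

instance (S : ClosedSubmodule ℂ (HardySpace 1 E)) : CompleteSpace (wandering S) :=
  (S.isClosed.inter (Submodule.isClosed_orthogonal _)).completeSpace_coe

/-- The operator `P_S M_z^*` on `S`. -/
def compBackShift (S : ClosedSubmodule ℂ (HardySpace 1 E)) : S.toSubmodule →L[ℂ] S.toSubmodule :=
  S.toSubmodule.orthogonalProjectionOnto ∘L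
    ContinuousLinearMap.adjoint (shiftZ (E := E)) ∘L S.toSubmodule.subtypeL

/-- The `B(W)`-valued function `w ↦ P_W (I_S - w P_S M_z^*)⁻¹ P_S C|_W` on the disc, `W = S ⊖ zS`,
attached to a bounded operator `C` on `H²_E(𝔻)`. The inverse is taken in `B(S)`, where
`I_S - w P_S M_z^*` is invertible for `|w| < 1`. -/
def symbolOf (S : ClosedSubmodule ℂ (HardySpace 1 E)) (C : HardySpace 1 E →L[ℂ] HardySpace 1 E)
    (w : ℂ) : wandering S →L[ℂ] wandering S :=
  (wandering S).orthogonalProjectionOnto ∘L S.toSubmodule.subtypeL ∘L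
    Ring.inverse (1 - w • compBackShift S) ∘L
    S.toSubmodule.orthogonalProjectionOnto ∘L C ∘L (wandering S).subtypeL

end Disc

section Kappa

variable {n : ℕ} {E : Type*} [NormedAddCommGroup E] [InnerProductSpace ℂ E]

/-- The constant function `κᵢ(w) = M_{z_i} ∈ B(E_n)`, where `E_n = H²_E(𝔻ⁿ)`. -/
def kappa (i : Fin n) : ℂ → HardySpace n E →L[ℂ] HardySpace n E :=
  fun _ => HardySpace.mulCoord i

/-- The operator `M_{κᵢ}` on `H²_{E_n}(𝔻)`, `(M_{κᵢ} f)(w) = κᵢ(w) f(w)`. -/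
def mulKappa (i : Fin n) :
    HardySpace 1 (HardySpace n E) →L[ℂ] HardySpace 1 (HardySpace n E) :=
  HardySpace.mulConst (HardySpace.mulCoord i)

theorem isMulOp_mulKappa [CompleteSpace E] (i : Fin n) :
    IsMulOp (kappa (E := E) i) (mulKappa i) :=
  fun _ _ => HardySpace.mulConst_apply _ _ _

end Kappa

end

/-! Suppose `S` is invariant under `M_z`, and put `L = P_S M_z^*|_S`. For `f ∈ S`, splitting off the
part in `zS` gives `f = P_W f + z L f`. Iterating, `f = ∑_{j<m} z^j P_W L^j f + z^m L^m f`, where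
the remainder has no Taylor coefficients below order `m`. Hence `g ↦ ∑ z^k g_k` is a unitary from
`H²_W(𝔻)` onto `S` (`synthesisEquiv`). It is multiplication by the inner function `Θ(w)η = η(w)`
(`exists_isInner_synthesis`).

The inverse unitary sends `f` to the function with coefficients `P_W L^k f`, whose value at `w` is
`P_W (I - wL)⁻¹ f` (`evalAt_analysis`). This is where the formula for `Φ_i` comes from: an operator
`C` that preserves `S` and commutes with `M_z` becomes multiplication by `w ↦ P_W (I - wL)⁻¹ C|_W`
(`isMulOp_transport`). Isometry and commutation pass through the unitary. So does the absence of a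
unitary part, because the ranges of the powers of `M_{κ_i}` intersect in `0`.

Conversely, if `S = Θ H²_W`, then `zΘg = Θ(zg)` and `κ_i Θ g = Θ(Φ_i g)` are again in `S`. -/

noncomputable section

/-! ### Coordinate shifts, Taylor coefficients and contractivity of isometric multipliers. -/

namespace HardySpace

section Basic

variable {n : ℕ} {E F : Type*} [NormedAddCommGroup E] [InnerProductSpace ℂ E]
  [NormedAddCommGroup F] [InnerProductSpace ℂ F]

theorem norm_mulCoord (i : Fin n) (f : HardySpace n E) : ‖mulCoord i f‖ = ‖f‖ := by
  rw [norm_eq, norm_eq, coeff_mulCoord, norm_extend_sq, tsum_extend_zero (shiftIdx_injective i)]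

theorem norm_pow_mulCoord (i : Fin n) (m : ℕ) (f : HardySpace n E) :
    ‖(mulCoord i ^ m) f‖ = ‖f‖ := by
  induction m with
  | zero => simp
  | succ m ih => rw [pow_succ', mul_apply_eq_comp, norm_mulCoord, ih]

theorem inner_mulCoord (i : Fin n) (f g : HardySpace n E) :
    inner ℂ (mulCoord i f) (mulCoord i g) = inner ℂ f g :=
  LinearIsometry.inner_map_map ⟨(mulCoord i).toLinearMap, norm_mulCoord i⟩ f g

theorem inner_pow_mulCoord (i : Fin n) (m : ℕ) (f g : HardySpace n E) :
    inner ℂ ((mulCoord i ^ m) f) ((mulCoord i ^ m) g) = inner ℂ f g :=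
  LinearIsometry.inner_map_map ⟨(mulCoord i ^ m).toLinearMap, norm_pow_mulCoord i m⟩ f g

theorem adjoint_mulCoord_mulCoord [CompleteSpace E] (i : Fin n) (f : HardySpace n E) :
    ContinuousLinearMap.adjoint (mulCoord i) (mulCoord i f) = f :=
  ext_inner_right ℂ fun g => by
    rw [ContinuousLinearMap.adjoint_inner_left, inner_mulCoord]

/-- Each factor raises the `i`-th exponent by one. This is the purity of the shift; it removes the
remainder in the Wold decomposition and the unitary part of `M_{κ_i}`. -/
theorem coeff_pow_mulCoord_of_lt (i : Fin n) (f : HardySpace n E) :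
    ∀ (m : ℕ) (k : Fin n → ℕ), k i < m → ((mulCoord i ^ m) f).coeff k = 0
  | 0, _, h => absurd h (Nat.not_lt_zero _)
  | m + 1, k, h => by
    rw [pow_succ', mul_apply_eq_comp, coeff_mulCoord]
    by_cases hk : ∃ j, shiftIdx i j = k
    · obtain ⟨j, rfl⟩ := hk
      rw [extend_shiftIdx]
      refine coeff_pow_mulCoord_of_lt i f m j ?_
      simpa [shiftIdx] using h
    · rw [Function.extend_apply' _ _ _ hk, Pi.zero_apply]

/-- The `k`-th Taylor coefficient as a bounded operator. -/
def coeffCLM (k : Fin n → ℕ) : HardySpace n E →L[ℂ] E :=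
  LinearMap.mkContinuous
    { toFun := fun f => f.coeff k
      map_add' := fun _ _ => rfl
      map_smul' := fun _ _ => rfl } 1 fun f => by
      rw [one_mul]
      exact f.norm_coeff_le k

theorem coeffCLM_apply (k : Fin n → ℕ) (f : HardySpace n E) : coeffCLM k f = f.coeff k := rfl

theorem coeff_mulConst (K : E →L[ℂ] F) (f : HardySpace n E) (k : Fin n → ℕ) :
    (mulConst K f).coeff k = K (f.coeff k) := rfl

theorem norm_mulConst {K : E →L[ℂ] F} (hK : ∀ x, ‖K x‖ = ‖x‖) (f : HardySpace n E) :
    ‖mulConst K f‖ = ‖f‖ := by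
  simp only [norm_eq, coeff_mulConst, hK]

theorem hasSum_apply [CompleteSpace E] (f : HardySpace n E) (z : Fin n → 𝔻) :
    HasSum (fun k => polyMono z k • f.coeff k) (f z) :=
  (summable_polyMono_smul z f.norm_coeff_le).hasSum

theorem mulCoord_mulCoord_comm [CompleteSpace E] (i j : Fin n) (f : HardySpace n E) :
    mulCoord i (mulCoord j f) = mulCoord j (mulCoord i f) :=
  DFunLike.ext _ _ fun z => by simp only [mulCoord_apply, smul_comm (z i : ℂ)]

theorem mulCoord_mulConst [CompleteSpace E] [CompleteSpace F] (i : Fin n) (K : E →L[ℂ] F)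
    (f : HardySpace n E) : mulCoord i (mulConst K f) = mulConst K (mulCoord i f) :=
  DFunLike.ext _ _ fun z => by simp only [mulCoord_apply, mulConst_apply, map_smul]

theorem norm_kerFun_apply_sq [CompleteSpace E] (w : 𝔻) (v : E) :
    ‖RKHS.kerFun (HardySpace 1 E) (fun _ => w) v‖ ^ 2 = (1 - ‖(w : ℂ)‖ ^ 2)⁻¹ * ‖v‖ ^ 2 := by
  have h : inner ℂ (RKHS.kerFun (HardySpace 1 E) (fun _ => w) v)
      (RKHS.kerFun (HardySpace 1 E) (fun _ => w) v) =
      (((1 - ‖(w : ℂ)‖ ^ 2)⁻¹ * ‖v‖ ^ 2 : ℝ) : ℂ) := by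
    rw [RKHS.kerFun_inner, RKHS.kerFun_apply, kernel_eq]
    simp only [Finset.univ_unique, Finset.prod_const, Finset.card_singleton, pow_one,
      _root_.smul_apply, ContinuousLinearMap.id_apply, inner_smul_right,
      inner_self_eq_norm_sq_to_K, Complex.mul_conj']
    push_cast
    rfl
  rw [inner_self_eq_norm_sq_to_K] at h
  refine Complex.ofReal_injective ?_
  rw [← h]
  push_cast
  rfl

/-- The values of an isometric multiplier are contractions. -/
theorem norm_apply_le_of_isometry [CompleteSpace E] [CompleteSpace F] {Θ : ℂ → E →L[ℂ] F}
    {T : HardySpace 1 E →L[ℂ] HardySpace 1 F} (hT : IsMulOp Θ T) (hn : ∀ f, ‖T f‖ = ‖f‖)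
    (w : 𝔻) (v : E) : ‖Θ w v‖ ≤ ‖v‖ := by
  set c : ℝ := 1 - ‖(w : ℂ)‖ ^ 2 with hc
  have hc0 : 0 < c := by
    have := w.norm_lt_one
    have := norm_nonneg (w : ℂ)
    nlinarith
  -- Cauchy–Schwarz for `k_w x` against `T (k_w v)`, with `x = Θ(w)v`, gives `c⁻¹‖x‖² ≤ ‖k_w x‖ ‖k_w
  -- v‖ = c⁻¹‖x‖ ‖v‖`. It is squared below to avoid square roots of `c`.
  let x := Θ w v
  let kv := RKHS.kerFun (HardySpace 1 E) (fun _ => w) v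
  let kx := RKHS.kerFun (HardySpace 1 F) (fun _ => w) x
  have hkv : kv.evalAt w = ((c⁻¹ : ℝ) : ℂ) • v := by
    simp only [kv, HardySpace.evalAt]
    rw [RKHS.kerFun_apply, kernel_eq]
    simp [Complex.mul_conj', hc]
  have h1 : inner ℂ kx (T kv) = ((c⁻¹ * ‖x‖ ^ 2 : ℝ) : ℂ) := by
    have : inner ℂ kx (T kv) = inner ℂ x ((T kv).evalAt w) := RKHS.kerFun_inner _ _ _
    rw [this, hT, hkv, map_smul, inner_smul_right, inner_self_eq_norm_sq_to_K]
    push_cast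
    rfl
  have h2 : c⁻¹ * ‖x‖ ^ 2 ≤ ‖kx‖ * ‖kv‖ := by
    have := norm_inner_le_norm (𝕜 := ℂ) kx (T kv)
    rwa [h1, hn, Complex.norm_real, Real.norm_of_nonneg (by positivity)] at this
  have h3 : (c⁻¹ * ‖x‖ ^ 2) ^ 2 ≤ (c⁻¹ * ‖x‖ ^ 2) * (c⁻¹ * ‖v‖ ^ 2) := by
    have ex : ‖kx‖ ^ 2 = c⁻¹ * ‖x‖ ^ 2 := norm_kerFun_apply_sq w x
    have ev : ‖kv‖ ^ 2 = c⁻¹ * ‖v‖ ^ 2 := norm_kerFun_apply_sq w v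
    have := pow_le_pow_left₀ (by positivity) h2 2
    rwa [mul_pow ‖kx‖, ex, ev] at this
  have h4 : ‖x‖ ^ 2 * ‖x‖ ^ 2 ≤ ‖x‖ ^ 2 * ‖v‖ ^ 2 := by
    have : (c⁻¹) ^ 2 * (‖x‖ ^ 2 * ‖x‖ ^ 2) ≤ (c⁻¹) ^ 2 * (‖x‖ ^ 2 * ‖v‖ ^ 2) := by nlinarith
    exact le_of_mul_le_mul_left this (by positivity)
  rcases (norm_nonneg x).eq_or_lt with h0 | h0
  · change ‖x‖ ≤ ‖v‖
    rw [← h0]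
    exact norm_nonneg v
  · exact (sq_le_sq₀ (norm_nonneg x) (norm_nonneg v)).mp
      (le_of_mul_le_mul_left h4 (by positivity))

end Basic

/-- Every bounded sequence of operators is the coefficient sequence of an analytic function on the
disc. -/
theorem exists_analytic_sum {X : Type*} [NormedAddCommGroup X] [NormedSpace ℂ X]
    [CompleteSpace X] {c : ℕ → X} {C : ℝ} (hc : ∀ m, ‖c m‖ ≤ C) :
    ∃ Θ : ℂ → X, DifferentiableOn ℂ Θ (Metric.ball 0 1) ∧
      ∀ w ∈ Metric.ball (0 : ℂ) 1, HasSum (fun m => w ^ m • c m) (Θ w) := by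
  let p : FormalMultilinearSeries ℂ ℂ X := fun m =>
    ContinuousMultilinearMap.mkPiRing ℂ (Fin m) (c m)
  have hr : (1 : ℝ≥0∞) ≤ p.radius := by
    have := p.le_radius_of_bound C (r := 1) fun m => by simpa [p] using hc m
    simpa using this
  have hp := (p.hasFPowerSeriesOnBall (lt_of_lt_of_le one_pos hr)).mono one_pos hr
  have hb : Metric.eball (0 : ℂ) 1 = Metric.ball 0 1 := by
    simpa using Metric.eball_ofReal (x := (0 : ℂ)) (ε := 1)
  refine ⟨p.sum, hb ▸ hp.differentiableOn, fun w hw => ?_⟩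
  have := hp.hasSum (y := w) (hb ▸ hw)
  simpa [p] using this

end HardySpace

/-! ### The Wold decomposition of an invariant subspace -/

namespace HardySpace

section Neumann

variable {X : Type*} [NormedAddCommGroup X] [NormedSpace ℂ X] {A : X →L[ℂ] X}

theorem norm_smul_lt_one_of_norm_le_one (hA : ‖A‖ ≤ 1) (w : 𝔻) : ‖(w : ℂ) • A‖ < 1 := by
  rw [norm_smul]
  exact mul_lt_one_of_nonneg_of_lt_one_left (norm_nonneg _) w.norm_lt_one hA

variable [CompleteSpace X]

theorem hasSum_ringInverse_one_sub_smul (hA : ‖A‖ ≤ 1) (w : 𝔻) (x : X) :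
    HasSum (fun m : ℕ => (w : ℂ) ^ m • (A ^ m) x) (Ring.inverse (1 - (w : ℂ) • A) x) := by
  have hlt := norm_smul_lt_one_of_norm_le_one hA w
  have h : HasSum (fun m : ℕ => ((w : ℂ) • A) ^ m) (Ring.inverse (1 - (w : ℂ) • A)) := by
    exact hasSum_geom_series_inverse _ hlt
  simpa [smul_pow] using h.mapL (ContinuousLinearMap.apply ℂ X x)

/-- Apply the inverse to `(1 - wA)y = y - wx`. With `A = L`, `y = zf`, `x = f`, this turns `M_z` on
`S` into multiplication by `w`. -/
theorem ringInverse_one_sub_smul_apply (hA : ‖A‖ ≤ 1) (w : 𝔻) {x y : X} (h : A y = x) :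
    Ring.inverse (1 - (w : ℂ) • A) y = y + (w : ℂ) • Ring.inverse (1 - (w : ℂ) • A) x := by
  have hu := isUnit_one_sub_of_norm_lt_one (norm_smul_lt_one_of_norm_le_one hA w)
  let R : X →L[ℂ] X := Ring.inverse (1 - (w : ℂ) • A)
  have h1 : (1 - (w : ℂ) • A : X →L[ℂ] X) y = y - (w : ℂ) • x := by simp [h]
  have h2 := congrArg R h1
  rw [← mul_apply_eq_comp, Ring.inverse_mul_cancel _ hu, map_sub, map_smul,
    one_apply_eq_self] at h2
  exact (eq_sub_iff_add_eq.mp h2).symm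

end Neumann

section Wold

variable {E : Type*} [NormedAddCommGroup E] [InnerProductSpace ℂ E]
  {S : ClosedSubmodule ℂ (HardySpace 1 E)}

theorem mem_wandering_iff {f : HardySpace 1 E} :
    f ∈ wandering S ↔ f ∈ S ∧ ∀ h ∈ S, inner ℂ (shiftZ h) f = 0 := by
  simp only [wandering, Submodule.mem_inf, Submodule.mem_orthogonal, Submodule.mem_map,
    forall_exists_index, and_imp, forall_apply_eq_imp_iff₂]
  rfl

theorem mem_of_mem_wandering {f : HardySpace 1 E} (hf : f ∈ wandering S) : f ∈ S :=
  (mem_wandering_iff.mp hf).1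

theorem pow_shiftZ_mem (hS : ∀ f ∈ S, shiftZ f ∈ S) (m : ℕ) {f : HardySpace 1 E} (hf : f ∈ S) :
    (shiftZ ^ m) f ∈ S := by
  induction m with
  | zero => simpa using hf
  | succ m ih => rw [pow_succ', mul_apply_eq_comp]; exact hS _ ih

/-- Cancelling the isometry `z^j` leaves an element of `W` paired with a positive power of `z` times
an element of `S`, that is, with an element of `zS`. -/
theorem inner_pow_shiftZ_of_lt (hS : ∀ f ∈ S, shiftZ f ∈ S) {j k : ℕ} (h : j < k)
    (a b : wandering S) :
    inner ℂ ((shiftZ ^ j) (a : HardySpace 1 E)) ((shiftZ ^ k) (b : HardySpace 1 E)) = 0 := by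
  obtain ⟨m, rfl⟩ := Nat.exists_eq_add_of_lt h
  rw [add_assoc, pow_add, mul_apply_eq_comp, inner_pow_mulCoord, pow_succ', mul_apply_eq_comp,
    ← inner_conj_symm, (mem_wandering_iff.mp a.2).2 _
      (pow_shiftZ_mem hS m (mem_of_mem_wandering b.2)), map_zero]

/-- The isometry `η ↦ z ^ k η` on the wandering subspace. -/
def shiftPow (S : ClosedSubmodule ℂ (HardySpace 1 E)) (k : Fin 1 → ℕ) :
    wandering S →ₗᵢ[ℂ] HardySpace 1 E :=
  ⟨((shiftZ ^ k 0) ∘L (wandering S).subtypeL).toLinearMap, fun x => norm_pow_mulCoord 0 (k 0) x.1⟩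

theorem orthogonalFamily_shiftPow (hS : ∀ f ∈ S, shiftZ f ∈ S) :
    OrthogonalFamily ℂ (fun _ : Fin 1 → ℕ => wandering S) (shiftPow S) := by
  intro j k hjk a b
  have h0 : j 0 ≠ k 0 := fun h => hjk (funext fun i => by rwa [Subsingleton.elim i 0])
  rcases h0.lt_or_gt with h | h
  · exact inner_pow_shiftZ_of_lt hS h a b
  · rw [← inner_conj_symm]
    exact (congrArg _ (inner_pow_shiftZ_of_lt hS h b a)).trans (map_zero _)

variable [CompleteSpace E]

/-- The orthogonal projection of `S` onto its wandering subspace. -/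
def wanderingProj (S : ClosedSubmodule ℂ (HardySpace 1 E)) : S.toSubmodule →L[ℂ] wandering S :=
  (wandering S).orthogonalProjectionOnto ∘L S.toSubmodule.subtypeL

/-- The isometry `g ↦ ∑ₖ z ^ k gₖ` from `H²_W(𝔻)` onto the invariant subspace `S`. -/
def synthesis (hS : ∀ f ∈ S, shiftZ f ∈ S) : HardySpace 1 (wandering S) →ₗᵢ[ℂ] HardySpace 1 E :=
  (orthogonalFamily_shiftPow hS).linearIsometry.comp toLp.toLinearIsometry

theorem hasSum_synthesis (hS : ∀ f ∈ S, shiftZ f ∈ S) (g : HardySpace 1 (wandering S)) :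
    HasSum (fun k : Fin 1 → ℕ => (shiftZ ^ k 0) (g.coeff k : HardySpace 1 E)) (synthesis hS g) :=
  (orthogonalFamily_shiftPow hS).hasSum_linearIsometry (toLp g)

theorem synthesis_mem (hS : ∀ f ∈ S, shiftZ f ∈ S) (g : HardySpace 1 (wandering S)) :
    synthesis hS g ∈ S :=
  S.isClosed.mem_of_tendsto (hasSum_synthesis hS g) (Filter.Eventually.of_forall fun _ =>
    S.toSubmodule.sum_mem fun _ _ => pow_shiftZ_mem hS _ (mem_of_mem_wandering (Subtype.prop _)))

theorem inner_compBackShift (f : S.toSubmodule)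
    {h : HardySpace 1 E} (hh : h ∈ S) :
    inner ℂ h (compBackShift S f : HardySpace 1 E) = inner ℂ (shiftZ h) (f : HardySpace 1 E) := by
  have := S.toSubmodule.inner_orthogonalProjectionOnto_eq_of_mem_left ⟨h, hh⟩
    (ContinuousLinearMap.adjoint (shiftZ (E := E)) f)
  rw [ContinuousLinearMap.adjoint_inner_right] at this
  exact this

theorem compBackShift_shiftZ (hS : ∀ f ∈ S, shiftZ f ∈ S) (f : S.toSubmodule) :
    compBackShift S ⟨shiftZ f, hS f f.2⟩ = f := by
  change S.toSubmodule.orthogonalProjectionOnto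
    (ContinuousLinearMap.adjoint (shiftZ (E := E)) (shiftZ f)) = f
  rw [adjoint_mulCoord_mulCoord]
  exact S.toSubmodule.orthogonalProjectionOnto_mem_subspace_eq_self f

theorem wanderingProj_shiftZ (hS : ∀ f ∈ S, shiftZ f ∈ S) (f : S.toSubmodule) :
    wanderingProj S ⟨shiftZ f, hS f f.2⟩ = 0 := by
  change (wandering S).orthogonalProjectionOnto (shiftZ (f : HardySpace 1 E)) = 0
  refine (wandering S).orthogonalProjectionOnto_apply_of_mem_orthogonal ?_
  rw [Submodule.mem_orthogonal]
  intro u hu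
  rw [← inner_conj_symm]
  exact (congrArg _ ((mem_wandering_iff.mp hu).2 f f.2)).trans (map_zero _)

/-- One step of the Wold decomposition: `f - zLf` is orthogonal to `zS` because `⟨zh, zLf⟩ = ⟨h, Lf⟩
= ⟨zh, f⟩` for `h ∈ S`. Since `zLf` is orthogonal to `W`, this difference is `P_W f`. -/
theorem wanderingProj_add_shiftZ (hS : ∀ f ∈ S, shiftZ f ∈ S) (f : S.toSubmodule) :
    (wanderingProj S f : HardySpace 1 E) + shiftZ (compBackShift S f : HardySpace 1 E) = f := by
  have h1 : (f : HardySpace 1 E) - shiftZ (compBackShift S f : HardySpace 1 E) ∈ wandering S := by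
    refine mem_wandering_iff.mpr ⟨S.toSubmodule.sub_mem f.2 (hS _ (compBackShift S f).2),
      fun h hh => ?_⟩
    rw [inner_sub_right, inner_mulCoord, inner_compBackShift f hh, sub_self]
  have h2 : f = ⟨_, mem_of_mem_wandering h1⟩ + ⟨_, hS _ (compBackShift S f).2⟩ :=
    Subtype.ext (sub_add_cancel _ _).symm
  have h3 : wanderingProj S f = ⟨_, h1⟩ := by
    conv_lhs => rw [h2, map_add, wanderingProj_shiftZ hS, add_zero]
    exact (wandering S).orthogonalProjectionOnto_mem_subspace_eq_self ⟨_, h1⟩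
  rw [h3]
  exact sub_add_cancel _ _

theorem norm_sq_eq_wanderingProj_add (hS : ∀ f ∈ S, shiftZ f ∈ S) (f : S.toSubmodule) :
    ‖f‖ ^ 2 = ‖wanderingProj S f‖ ^ 2 + ‖compBackShift S f‖ ^ 2 := by
  have h := norm_add_sq_eq_norm_sq_add_norm_sq_of_inner_eq_zero (𝕜 := ℂ)
    (wanderingProj S f : HardySpace 1 E) (shiftZ (compBackShift S f : HardySpace 1 E)) (by
      rw [← inner_conj_symm, (mem_wandering_iff.mp (wanderingProj S f).2).2 _
        (compBackShift S f).2, map_zero])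
  rw [wanderingProj_add_shiftZ hS, norm_mulCoord] at h
  simpa [sq] using h

/-- Pythagoras, telescoped; it bounds the partial sums that make `analysis` square summable. -/
theorem sum_norm_sq_wanderingProj (hS : ∀ f ∈ S, shiftZ f ∈ S) (f : S.toSubmodule) (m : ℕ) :
    ∑ j ∈ Finset.range m, ‖wanderingProj S ((compBackShift S ^ j) f)‖ ^ 2 +
      ‖(compBackShift S ^ m) f‖ ^ 2 = ‖f‖ ^ 2 := by
  induction m with
  | zero => simp
  | succ m ih =>
    rw [← ih, Finset.sum_range_succ, norm_sq_eq_wanderingProj_add hS ((compBackShift S ^ m) f),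
      pow_succ' (compBackShift S), mul_apply_eq_comp, add_assoc]

theorem sum_pow_shiftZ_wanderingProj (hS : ∀ f ∈ S, shiftZ f ∈ S) (f : S.toSubmodule) (m : ℕ) :
    ∑ j ∈ Finset.range m,
        (shiftZ ^ j) (wanderingProj S ((compBackShift S ^ j) f) : HardySpace 1 E) +
      (shiftZ ^ m) ((compBackShift S ^ m) f : HardySpace 1 E) = f := by
  induction m with
  | zero => simp
  | succ m ih =>
    conv_rhs => rw [← ih, ← wanderingProj_add_shiftZ hS ((compBackShift S ^ m) f), map_add]
    rw [Finset.sum_range_succ, pow_succ' (compBackShift S), pow_succ (shiftZ (E := E)),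
      mul_apply_eq_comp, mul_apply_eq_comp, add_assoc]

/-- The element of `H²_W(𝔻)` with coefficients `P_W (P_S M_z^*) ^ k f`. -/
def analysis (hS : ∀ f ∈ S, shiftZ f ∈ S) (f : S.toSubmodule) : HardySpace 1 (wandering S) :=
  ofCoeff (fun k => wanderingProj S ((compBackShift S ^ k 0) f)) (by
    refine memℓp_gen ?_
    simp only [ENNReal.toReal_ofNat, Real.rpow_ofNat]
    refine (Equiv.funUnique (Fin 1) ℕ).summable_iff
      (f := fun k : ℕ => ‖wanderingProj S ((compBackShift S ^ k) f)‖ ^ 2).mpr ?_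
    refine summable_of_sum_range_le (c := ‖f‖ ^ 2) (fun _ => by positivity) fun m => ?_
    rw [← sum_norm_sq_wanderingProj hS f m]
    exact le_add_of_nonneg_right (by positivity))

theorem coeff_analysis (hS : ∀ f ∈ S, shiftZ f ∈ S) (f : S.toSubmodule) (k : Fin 1 → ℕ) :
    (analysis hS f).coeff k = wanderingProj S ((compBackShift S ^ k 0) f) := rfl

theorem synthesis_analysis (hS : ∀ f ∈ S, shiftZ f ∈ S) (f : S.toSubmodule) :
    synthesis hS (analysis hS f) = f := by
  have h := hasSum_synthesis hS (analysis hS f)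
  simp only [coeff_analysis] at h
  have h' : HasSum (fun j : ℕ =>
      (shiftZ ^ j) (wanderingProj S ((compBackShift S ^ j) f) : HardySpace 1 E))
      (synthesis hS (analysis hS f)) :=
    (Equiv.funUnique (Fin 1) ℕ).hasSum_iff.mp h
  -- The remainder `z^m L^m f` needs no norm estimate: its coefficient at `k` vanishes once `m > k`,
  -- so the coefficients of the partial sums are eventually those of `f`.
  refine coeff_ext fun k => ?_
  have ht := ((coeffCLM k).continuous.tendsto _).comp h'.tendsto_sum_nat
  refine tendsto_nhds_unique ht (tendsto_const_nhds.congr' ?_)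
  filter_upwards [Filter.eventually_gt_atTop (k 0)] with m hm
  have := congrArg (coeffCLM k) (sum_pow_shiftZ_wanderingProj hS f m)
  rw [map_add, coeffCLM_apply k ((shiftZ ^ m) _), coeff_pow_mulCoord_of_lt 0 _ m k hm,
    add_zero] at this
  exact this.symm

/-- The unitary from `H²_W(𝔻)` onto the invariant subspace `S`. -/
def synthesisEquiv (hS : ∀ f ∈ S, shiftZ f ∈ S) :
    HardySpace 1 (wandering S) ≃ₗᵢ[ℂ] S.toSubmodule :=
  LinearIsometryEquiv.ofSurjective
    ⟨(synthesis hS).toLinearMap.codRestrict S.toSubmodule (synthesis_mem hS),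
      (synthesis hS).norm_map⟩
    fun f => ⟨analysis hS f, Subtype.ext (synthesis_analysis hS f)⟩

theorem synthesisEquiv_symm (hS : ∀ f ∈ S, shiftZ f ∈ S) (f : S.toSubmodule) :
    (synthesisEquiv hS).symm f = analysis hS f :=
  (synthesisEquiv hS).symm_apply_eq.mpr (Subtype.ext (synthesis_analysis hS f)).symm

theorem norm_compBackShift_le (S : ClosedSubmodule ℂ (HardySpace 1 E)) : ‖compBackShift S‖ ≤ 1 := by
  refine ContinuousLinearMap.opNorm_le_bound _ zero_le_one fun f => ?_
  refine (S.toSubmodule.norm_orthogonalProjectionOnto_apply_le _).trans ?_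
  refine ((ContinuousLinearMap.adjoint (shiftZ (E := E))).le_opNorm (f : HardySpace 1 E)).trans ?_
  refine mul_le_mul_of_nonneg_right ?_ (norm_nonneg _)
  rw [LinearIsometryEquiv.norm_map]
  exact ContinuousLinearMap.opNorm_le_bound _ zero_le_one fun g => by
    rw [norm_mulCoord, one_mul]

theorem completeSpace_toSubmodule (S : ClosedSubmodule ℂ (HardySpace 1 E)) :
    CompleteSpace S.toSubmodule :=
  S.isClosed.completeSpace_coe

/-- The resolvent operator `P_W (I_S - w P_S M_z^*)⁻¹` on `S`. -/
def wanderingResolvent (S : ClosedSubmodule ℂ (HardySpace 1 E)) (w : ℂ) :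
    S.toSubmodule →L[ℂ] wandering S :=
  wanderingProj S ∘L Ring.inverse (1 - w • compBackShift S)

theorem symbolOf_apply (C : HardySpace 1 E →L[ℂ] HardySpace 1 E) (w : ℂ) (η : wandering S)
    (h : C η ∈ S) : symbolOf S C w η = wanderingResolvent S w ⟨C η, h⟩ := by
  have : S.toSubmodule.orthogonalProjectionOnto (C η) = ⟨C η, h⟩ :=
    S.toSubmodule.orthogonalProjectionOnto_mem_subspace_eq_self ⟨C η, h⟩
  rw [← this]
  rfl

/-- The Neumann series of `(I - wL)⁻¹`, projected to `W`, is exactly the Taylor series with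
coefficients `P_W L^k f`. -/
theorem evalAt_analysis (hS : ∀ f ∈ S, shiftZ f ∈ S) (f : S.toSubmodule) (w : 𝔻) :
    (analysis hS f).evalAt w = wanderingResolvent S w f := by
  have := completeSpace_toSubmodule S
  have h := (hasSum_ringInverse_one_sub_smul (norm_compBackShift_le S) w f).mapL (wanderingProj S)
  refine (hasSum_apply (analysis hS f) fun _ => w).unique ?_
  rw [← (Equiv.funUnique (Fin 1) ℕ).symm.hasSum_iff]
  have e : (fun m : ℕ => wanderingProj S ((w : ℂ) ^ m • (compBackShift S ^ m) f)) =
      (fun k => polyMono (fun _ => w) k • (analysis hS f).coeff k) ∘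
        (Equiv.funUnique (Fin 1) ℕ).symm := by
    funext m
    simp [polyMono, coeff_analysis]
  rw [e] at h
  exact h

theorem wanderingResolvent_shiftZ (hS : ∀ f ∈ S, shiftZ f ∈ S) (w : 𝔻) (f : S.toSubmodule) :
    wanderingResolvent S w ⟨shiftZ f, hS f f.2⟩ = (w : ℂ) • wanderingResolvent S w f := by
  have := completeSpace_toSubmodule S
  have h := congrArg (wanderingProj S) (ringInverse_one_sub_smul_apply (norm_compBackShift_le S) w
    (compBackShift_shiftZ hS f))
  rwa [map_add, wanderingProj_shiftZ hS, zero_add, map_smul] at h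

theorem wanderingResolvent_pow_shiftZ (hS : ∀ f ∈ S, shiftZ f ∈ S) (w : 𝔻)
    {f : HardySpace 1 E} (hf : f ∈ S) (m : ℕ) :
    wanderingResolvent S w ⟨(shiftZ ^ m) f, pow_shiftZ_mem hS m hf⟩ =
      (w : ℂ) ^ m • wanderingResolvent S w ⟨f, hf⟩ := by
  induction m with
  | zero => simp
  | succ m ih =>
    have := wanderingResolvent_shiftZ hS w ⟨(shiftZ ^ m) f, pow_shiftZ_mem hS m hf⟩
    rw [ih, smul_smul, ← pow_succ'] at this
    simpa only [pow_succ' (shiftZ (E := E)), mul_apply_eq_comp] using this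

end Wold

end HardySpace

namespace HardySpace

/-! ### The inner function of `S`, and operators on `S` viewed on `H²_W(𝔻)`. -/

section Multipliers

variable {E : Type*} [NormedAddCommGroup E] [InnerProductSpace ℂ E] [CompleteSpace E]

theorem pow_mulCoord_apply {n : ℕ} (i : Fin n) (m : ℕ) (f : HardySpace n E) (z : Fin n → 𝔻) :
    (mulCoord i ^ m) f z = (z i : ℂ) ^ m • f z := by
  induction m with
  | zero => simp
  | succ m ih => rw [pow_succ', mul_apply_eq_comp, mulCoord_apply, ih, smul_smul, ← pow_succ']

variable {S : ClosedSubmodule ℂ (HardySpace 1 E)}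

/-- The Beurling–Lax–Halmos theorem: an invariant subspace is the range of multiplication by an
inner function on `H²_W(𝔻)`, whose values are the point evaluations of elements of `W`. -/
theorem exists_isInner_synthesis (hS : ∀ f ∈ S, shiftZ f ∈ S) :
    ∃ Θ : ℂ → wandering S →L[ℂ] E, IsInner Θ ∧
      (∀ (w : 𝔻) (η : wandering S), Θ w η = (η : HardySpace 1 E).evalAt w) ∧
      IsMulOp Θ (synthesis hS).toContinuousLinearMap := by
  -- The `m`-th coefficient of `Θ` must be `η ↦ η_m`. This bound gives analyticity only; boundedness
  -- of `Θ` comes at the end from `norm_apply_le_of_isometry`.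
  have hc : ∀ m : ℕ, ‖(coeffCLM fun _ => m) ∘L (wandering S).subtypeL‖ ≤ 1 := fun m =>
    ContinuousLinearMap.opNorm_le_bound _ zero_le_one fun η => by
      rw [one_mul]
      exact (η : HardySpace 1 E).norm_coeff_le _
  obtain ⟨Θ, hd, hsum⟩ := exists_analytic_sum (X := wandering S →L[ℂ] E) hc
  have hev : ∀ (w : 𝔻) (η : wandering S), Θ w η = (η : HardySpace 1 E).evalAt w := by
    intro w η
    have h1 := (hsum w (by simpa using w.norm_lt_one)).mapL
      (ContinuousLinearMap.apply ℂ E η)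
    have h2 := hasSum_apply (η : HardySpace 1 E) fun _ => w
    rw [← (Equiv.funUnique (Fin 1) ℕ).symm.hasSum_iff] at h2
    refine h1.unique ?_
    have e : (fun k => polyMono (fun _ => w) k • (η : HardySpace 1 E).coeff k) ∘
        (Equiv.funUnique (Fin 1) ℕ).symm = fun m : ℕ => ContinuousLinearMap.apply ℂ E η
          ((w : ℂ) ^ m • (coeffCLM fun _ => m) ∘L (wandering S).subtypeL) := by
      funext m
      simp [polyMono, coeffCLM_apply]
      rfl
    rw [e] at h2
    exact h2
  have hmul : IsMulOp Θ (synthesis hS).toContinuousLinearMap := by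
    intro g w
    have h1 := (hasSum_synthesis hS g).mapL (evalCLM fun _ => w)
    have h2 := (hasSum_apply g fun _ => w).mapL (Θ w)
    refine h1.unique ?_
    have e : (fun k => Θ w (polyMono (fun _ => w) k • g.coeff k)) =
        fun k : Fin 1 → ℕ =>
          evalCLM (fun _ => w) ((shiftZ ^ k 0) (g.coeff k : HardySpace 1 E)) := by
      funext k
      have := pow_mulCoord_apply 0 (k 0) (g.coeff k : HardySpace 1 E) fun _ => w
      rw [map_smul, hev]
      refine Eq.trans ?_ this.symm
      simp [polyMono]
    rw [e] at h2
    exact h2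
  refine ⟨Θ, ⟨⟨hd, 1, fun w hw => ?_⟩, _, hmul, (synthesis hS).norm_map⟩, hev, hmul⟩
  refine ContinuousLinearMap.opNorm_le_bound _ zero_le_one fun η => ?_
  rw [one_mul]
  exact norm_apply_le_of_isometry hmul (synthesis hS).norm_map
    (Complex.UnitDisc.mk w (by simpa using hw)) η

variable {C : HardySpace 1 E →L[ℂ] HardySpace 1 E}

/-- The operator on `H²_W(𝔻)` which is unitarily equivalent to the restriction of `C` to the
invariant subspace `S`. -/
def transport (hS : ∀ f ∈ S, shiftZ f ∈ S) (hC : ∀ f ∈ S, C f ∈ S) :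
    HardySpace 1 (wandering S) →L[ℂ] HardySpace 1 (wandering S) :=
  (synthesisEquiv hS).symm.toContinuousLinearEquiv.toContinuousLinearMap ∘L
    (C ∘L S.toSubmodule.subtypeL).codRestrict S.toSubmodule (fun f => hC f f.2) ∘L
    (synthesisEquiv hS).toContinuousLinearEquiv.toContinuousLinearMap

theorem transport_apply (hS : ∀ f ∈ S, shiftZ f ∈ S) (hC : ∀ f ∈ S, C f ∈ S)
    (g : HardySpace 1 (wandering S)) :
    transport hS hC g = analysis hS ⟨C (synthesis hS g), hC _ (synthesis_mem hS g)⟩ :=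
  synthesisEquiv_symm hS _

theorem synthesis_transport (hS : ∀ f ∈ S, shiftZ f ∈ S) (hC : ∀ f ∈ S, C f ∈ S)
    (g : HardySpace 1 (wandering S)) :
    synthesis hS (transport hS hC g) = C (synthesis hS g) := by
  rw [transport_apply, synthesis_analysis]

/-- By continuity it suffices to treat `z^k η` with `η ∈ W`. There `C` passes through `z^k`, the
resolvent turns `z^k` into `w^k`, and what remains is the symbol applied to `η`. -/
theorem isMulOp_transport (hS : ∀ f ∈ S, shiftZ f ∈ S) (hC : ∀ f ∈ S, C f ∈ S)
    (hcomm : ∀ f, C (shiftZ f) = shiftZ (C f)) : IsMulOp (symbolOf S C) (transport hS hC) := by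
  intro g w
  rw [transport_apply, evalAt_analysis]
  -- Precomposing with `P_S` extends the resolvent to the whole space, so it can be applied to a
  -- series converging there.
  let L : HardySpace 1 E →L[ℂ] wandering S :=
    wanderingResolvent S w ∘L S.toSubmodule.orthogonalProjectionOnto
  have hL : ∀ {x : HardySpace 1 E} (hx : x ∈ S), L x = wanderingResolvent S w ⟨x, hx⟩ :=
    fun {x} hx => congrArg (wanderingResolvent S w)
      (S.toSubmodule.orthogonalProjectionOnto_mem_subspace_eq_self ⟨x, hx⟩)
  have hpow : ∀ (m : ℕ) (f : HardySpace 1 E), C ((shiftZ ^ m) f) = (shiftZ ^ m) (C f) := by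
    intro m f
    induction m with
    | zero => simp
    | succ m ih => rw [pow_succ', mul_apply_eq_comp, mul_apply_eq_comp, hcomm, ih]
  have h1 := (hasSum_synthesis hS g).mapL (L ∘L C)
  have h2 := (hasSum_apply g fun _ => w).mapL (symbolOf S C w)
  rw [← hL]
  refine h1.unique ?_
  have e : (fun k => symbolOf S C w (polyMono (fun _ => w) k • g.coeff k)) =
      fun k : Fin 1 → ℕ => (L ∘L C) ((shiftZ ^ k 0) (g.coeff k : HardySpace 1 E)) := by
    funext k
    have hk := hC _ (mem_of_mem_wandering (g.coeff k).2)
    rw [ContinuousLinearMap.comp_apply, hpow, hL (pow_shiftZ_mem hS _ hk),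
      wanderingResolvent_pow_shiftZ hS w hk, map_smul, symbolOf_apply C w _ hk]
    simp [polyMono]
  rw [e] at h2
  exact h2

theorem isShift_transport (hS : ∀ f ∈ S, shiftZ f ∈ S) (hC : ∀ f ∈ S, C f ∈ S)
    (hnorm : ∀ f, ‖C f‖ = ‖f‖) (hpure : ∀ f, (∀ m : ℕ, ∃ h, (C ^ m) h = f) → f = 0) :
    IsShift (transport hS hC) := by
  refine ⟨fun g => ?_, fun M _ _ _ hsurj => ?_⟩
  · rw [← (synthesis hS).norm_map, synthesis_transport, hnorm, (synthesis hS).norm_map]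
  · refine (Submodule.eq_bot_iff M).mpr fun g hg => ?_
    refine (synthesis hS).injective ?_
    rw [map_zero]
    refine hpure _ fun m => ?_
    -- Surjectivity on `M` can be iterated inside `M`, so its image in `S` lies in the range of
    -- every power of `C`.
    have : ∀ m : ℕ, ∀ g ∈ M, ∃ h ∈ M, (C ^ m) (synthesis hS h) = synthesis hS g := by
      intro m
      induction m with
      | zero => exact fun g hg => ⟨g, hg, by simp⟩
      | succ m ih =>
        intro g hg
        obtain ⟨h, hh, rfl⟩ := hsurj g hg
        obtain ⟨x, hx, e⟩ := ih h hh
        exact ⟨x, hx, by rw [pow_succ', mul_apply_eq_comp, e, synthesis_transport]⟩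
    obtain ⟨h, -, e⟩ := this m g hg
    exact ⟨_, e⟩

end Multipliers

/-! ### Purity and commutation of the operators `M_{κ_i}`. -/

section Kappa

variable {n : ℕ} {E : Type*} [NormedAddCommGroup E] [InnerProductSpace ℂ E]

theorem coeff_pow_mulKappa (i : Fin n) (m : ℕ) (f : HardySpace 1 (HardySpace n E))
    (k : Fin 1 → ℕ) : ((mulKappa i ^ m) f).coeff k = (mulCoord i ^ m) (f.coeff k) := by
  induction m with
  | zero => simp
  | succ m ih =>
    rw [pow_succ', pow_succ', mul_apply_eq_comp, mul_apply_eq_comp, ← ih]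
    rfl

theorem eq_zero_of_forall_mem_range_pow_mulKappa (i : Fin n) (f : HardySpace 1 (HardySpace n E))
    (h : ∀ m : ℕ, ∃ g, (mulKappa i ^ m) g = f) : f = 0 := by
  refine coeff_ext fun k => coeff_ext fun l => ?_
  -- The power `l i + 1` is the least one that forces the coefficient at `l` to vanish.
  obtain ⟨g, rfl⟩ := h (l i + 1)
  rw [coeff_pow_mulKappa, coeff_pow_mulCoord_of_lt i _ _ _ (Nat.lt_succ_self _)]
  rfl

theorem mulKappa_comm [CompleteSpace E] (i j : Fin n) (f : HardySpace 1 (HardySpace n E)) :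
    mulKappa i (mulKappa j f) = mulKappa j (mulKappa i f) :=
  coeff_ext fun _ => mulCoord_mulCoord_comm i j _

end Kappa

end HardySpace

end

/-! ### The characterization of invariant subspaces. -/

open HardySpace in
theorem theorem3p2 {E : Type*} [NormedAddCommGroup E] [InnerProductSpace ℂ E] [CompleteSpace E]
    {n : ℕ} (hn : 1 ≤ n) (S : ClosedSubmodule ℂ (HardySpace 1 (HardySpace n E))) :
    ((∀ f ∈ S, shiftZ f ∈ S) ∧ ∀ i : Fin n, ∀ f ∈ S, mulKappa i f ∈ S) ↔
      (∃ T : Fin n → HardySpace 1 (wandering S) →L[ℂ] HardySpace 1 (wandering S),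
        (∀ i, IsMulOp (symbolOf S (mulKappa i)) (T i)) ∧
        (∀ i, IsShift (T i)) ∧
        (∀ i j, T i ∘L T j = T j ∘L T i)) ∧
      ∃ Θ : ℂ → wandering S →L[ℂ] HardySpace n E,
        IsInner Θ ∧
        (∀ f, f ∈ S ↔ ∃ g : HardySpace 1 (wandering S), ∀ w : 𝔻, f.evalAt w = Θ w (g.evalAt w)) ∧
        (∀ i, ∀ w : 𝔻, kappa i w ∘L Θ w = Θ w ∘L symbolOf S (mulKappa i) w) := by
  constructor
  · rintro ⟨hS, hK⟩
    -- `M_z` acts on the disc variable and `M_{κ_i}` on the values in `E_n`.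
    have hcomm : ∀ (i : Fin n) (f : HardySpace 1 (HardySpace n E)),
        mulKappa i (shiftZ f) = shiftZ (mulKappa i f) :=
      fun i f => (mulCoord_mulConst 0 _ f).symm
    refine ⟨⟨fun i => transport hS (hK i), fun i => isMulOp_transport hS (hK i) (hcomm i),
      fun i => isShift_transport hS (hK i) (norm_mulConst (norm_mulCoord i))
        (eq_zero_of_forall_mem_range_pow_mulKappa i), fun i j => ?_⟩, ?_⟩
    · refine ContinuousLinearMap.ext fun g => (synthesis hS).injective ?_
      simp only [ContinuousLinearMap.comp_apply, synthesis_transport]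
      exact mulKappa_comm i j _
    · obtain ⟨Θ, hΘ, hev, hmul⟩ := exists_isInner_synthesis hS
      refine ⟨Θ, hΘ, fun f => ⟨fun hf => ⟨analysis hS ⟨f, hf⟩, fun w => ?_⟩, ?_⟩, fun i w => ?_⟩
      · rw [← hmul]
        exact congrArg (fun h => HardySpace.evalAt h w) (synthesis_analysis hS ⟨f, hf⟩).symm
      · rintro ⟨g, hg⟩
        have : f = synthesis hS g := DFunLike.ext _ _ fun z => by
          rw [show z = fun _ => z 0 from funext fun i => congrArg z (Subsingleton.elim i 0)]
          exact (hg (z 0)).trans (hmul g (z 0)).symm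
        exact this ▸ synthesis_mem hS g
      -- For `η ∈ W` both sides are the value at `w` of `M_{κ_i} η ∈ S`: the left directly, the
      -- right after writing this function as `Θ` times its analysis.
      · refine ContinuousLinearMap.ext fun η => ?_
        have hη := hK i _ (mem_of_mem_wandering η.2)
        rw [ContinuousLinearMap.comp_apply, ContinuousLinearMap.comp_apply, hev,
          symbolOf_apply _ _ _ hη, ← evalAt_analysis hS, ← hmul]
        exact (isMulOp_mulKappa i η.1 w).symm.trans
          (congrArg (fun h => HardySpace.evalAt h w) (synthesis_analysis hS ⟨_, hη⟩).symm)
  · rintro ⟨⟨T, hT, -, -⟩, Θ, -, hS, hΘ⟩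
    refine ⟨fun f hf => ?_, fun i f hf => ?_⟩
    · obtain ⟨g, hg⟩ := (hS f).mp hf
      refine (hS _).mpr ⟨shiftZ g, fun w => ?_⟩
      have h1 : (shiftZ f).evalAt w = (w : ℂ) • f.evalAt w := mulCoord_apply 0 f fun _ => w
      have h2 : (shiftZ g).evalAt w = (w : ℂ) • g.evalAt w := mulCoord_apply 0 g fun _ => w
      rw [h1, h2, hg, map_smul]
    · obtain ⟨g, hg⟩ := (hS f).mp hf
      -- Condition 1 enters here: `Φ_i g` belongs to `H²_W(𝔻)` because it is the function `T i g`.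
      refine (hS _).mpr ⟨T i g, fun w => ?_⟩
      rw [isMulOp_mulKappa i f w, hg, hT i g w]
      exact congrArg (fun L => L (g.evalAt w)) (hΘ i w)
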